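/- **Theorem (moderate deviations, sublinear regime).** Let $\lambda,\mu,\alpha>0$. On a probability space $(\Omega,\mathfrak F,\mathbf P)$ let $(\eta(k))_{k\ge 0}$ be a Markov chain on $\mathbb Z^+=\{0,1,2,\dots\}$ with $\eta(0)=0$ and transition probabilities $$\mathbf P(\eta(k+1)=j\mid \eta(k)=i)=\begin{cases}\frac{\lambda}{\lambda+\mu}, & i\ne 0,\ j=i+1,\\ \frac{\mu}{i(\lambda+\mu)}, & i\neq 0,\ 0\le j<i,\\ 1,& i=0,\ j=1,\end{cases}$$ (all other transition probabilities being $0$), and let $(\nu(t))_{t\ge0}$ be a Poisson process with rate $\alpha$ that is independent of $\eta$. Put $\xi(t)=\eta(\nu(t))$, $t\ge 0$ (the Poisson process with uniform catastrophes). Let $\varphi:[0,\infty)\to\mathbb R$ satisfy $$\lim_{T\to\infty}\frac{\varphi(T)}{T}=0\qquad\text{and}\qquad \lim_{T\to\infty}\frac{\varphi(T)}{T^{a}}=\infty\ \text{ for some } a\in(0,1),$$ and define $$I_1(x)=\begin{cases}\infty, & x<0,\\ x\ln\frac{\lambda+\mu}{\lambda}, & x\ge 0.\end{cases}$$ Then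 the family of random variables $\xi_T(1)=\xi(T)/\varphi(T)$ satisfies, as $T\to\infty$, the large deviation principle on $\mathbb R$ with normalizing function $\varphi(T)$ and rate function $I_1$. That is: $\varphi(T)\to\infty$ as $T\to\infty$; for every $c\ge 0$ the set $\{x\in\mathbb R: I_1(x)\le c\}$ is compact; and for every Borel set $B\subseteq\mathbb R$, with closure $[B]$ and interior $(B)$, $$\limsup_{T\to\infty}\frac1{\varphi(T)}\ln\mathbf P\Big(\frac{\xi(T)}{\varphi(T)}\in B\Big)\le-\inf_{x\in[B]}I_1(x),\qquad \liminf_{T\to\infty}\frac1{\varphi(T)}\ln\mathbf P\Big(\frac{\xi(T)}{\varphi(T)}\in B\Big)\ge-\inf_{x\in(B)}I_1(x),$$ where $\ln 0=-\infty$ and $\inf\emptyset=\infty$. -/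

import Mathlib

open MeasureTheory ProbabilityTheory Filter Topology
open scoped NNReal ENNReal

noncomputable section

/-- One-step transition probabilities of the embedded chain: from `i ≠ 0` the chain moves to `i + 1`
with probability `lam / (lam + mu)` and to each `j < i` with probability `mu / (i * (lam + mu))`;
from `0` it moves to `1`. -/
def transProb (lam mu : ℝ) (i j : ℕ) : ℝ :=
  if i = 0 then (if j = 1 then 1 else 0)
  else if j = i + 1 then lam / (lam + mu)
  else if j < i then mu / (i * (lam + mu))
  else 0

/-- `η` is a time-homogeneous Markov chain on `ℕ` with transition probabilities
`transProb lam mu`, started at `0`. -/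
structure IsCatastropheChain {Ω : Type*} [MeasurableSpace Ω] (P : Measure Ω)
    (lam mu : ℝ) (η : ℕ → Ω → ℕ) : Prop where
  measurable : ∀ k, Measurable (η k)
  init : ∀ᵐ ω ∂P, η 0 ω = 0
  markov : ∀ (k : ℕ) (x : ℕ → ℕ) (j : ℕ),
    P {ω | ∀ m ≤ k, η m ω = x m} ≠ 0 →
      P[{ω | η (k + 1) ω = j} | {ω | ∀ m ≤ k, η m ω = x m}]
        = ENNReal.ofReal (transProb lam mu (x k) j)

/-- `ν` is a (homogeneous) Poisson process with rate `α`. Since the paths are nondecreasing, the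
truncated subtraction of natural numbers is the true increment. -/
structure IsPoissonProcess {Ω : Type*} [MeasurableSpace Ω] (P : Measure Ω)
    (α : ℝ≥0) (ν : ℝ≥0 → Ω → ℕ) : Prop where
  measurable : ∀ t, Measurable (ν t)
  init : ∀ᵐ ω ∂P, ν 0 ω = 0
  path : ∀ᵐ ω ∂P, Monotone (fun t => ν t ω) ∧
    ∀ t, ContinuousWithinAt (fun s => ν s ω) (Set.Ici t) t
  indep_increments : HasIndepIncrements ν P
  law_increments : ∀ s t : ℝ≥0, s ≤ t →
    HasLaw (fun ω => ν t ω - ν s ω) (poissonMeasure (α * (t - s))) P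

/-- The time-changed chain `ξ(t) = η(ν(t))`. -/
def catastropheProcess {Ω : Type*} (η : ℕ → Ω → ℕ) (ν : ℝ≥0 → Ω → ℕ) (t : ℝ≥0) (ω : Ω) : ℕ :=
  η (ν t ω) ω

/-- The scaled process `ξ_T(t) = ξ(T t) / φ(T)`. -/
def scaledProcess {Ω : Type*} (ξ : ℝ≥0 → Ω → ℕ) (φ : ℝ≥0 → ℝ) (T t : ℝ≥0) (ω : Ω) : ℝ :=
  (ξ (T * t) ω : ℝ) / φ T

/-- The family of real random variables `X T` satisfies, as `T → ∞`, the large deviation principle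
on `ℝ` with normalizing function `ψ` and rate function `I`. The logarithm takes values in the
extended reals (`log 0 = -∞`), and the infimum over the empty set is `∞`. -/
structure SatisfiesLDP {Ω : Type*} [MeasurableSpace Ω] (P : Measure Ω)
    (X : ℝ≥0 → Ω → ℝ) (ψ : ℝ≥0 → ℝ) (I : ℝ → ℝ≥0∞) : Prop where
  tendsto_normalization : Tendsto ψ atTop atTop
  isCompact_sublevel : ∀ c : ℝ≥0, IsCompact {x : ℝ | I x ≤ c}
  upper_bound : ∀ B : Set ℝ, MeasurableSet B →
    limsup (fun T => ((1 / ψ T : ℝ) : EReal) * ENNReal.log (P {ω | X T ω ∈ B})) atTop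
      ≤ -((⨅ x ∈ closure B, I x : ℝ≥0∞) : EReal)
  lower_bound : ∀ B : Set ℝ, MeasurableSet B →
    -((⨅ x ∈ interior B, I x : ℝ≥0∞) : EReal)
      ≤ liminf (fun T => ((1 / ψ T : ℝ) : EReal) * ENNReal.log (P {ω | X T ω ∈ B})) atTop

/-- The rate function: `∞` on the negative half-line and `x ln ((lam + mu) / lam)` for `x ≥ 0`. -/
def rateI₁ (lam mu x : ℝ) : ℝ≥0∞ :=
  if x < 0 then ⊤ else ENNReal.ofReal (x * Real.log ((lam + mu) / lam))

end

/-!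
For `1 < z < (lam + mu) / lam` the function `i ↦ z ^ i` satisfies a geometric drift inequality for
the transition operator, because the catastrophes from `i` contribute only a fraction of order
`1 / i` of `z ^ i`. Hence `η k` has exponential tails of every rate below `log ((lam + mu) / lam)`,
uniformly in `k`, and so has `η` at any independent random time. This gives the upper bound.

For the lower bound, the chain is at `0` with probability bounded away from zero at every time from
`2` on: one step earlier it is in a fixed finite set of positive states with such a probability,
by tightness and since every state jumps to `0` with probability at most `mu / (lam + mu)`. From
`0` it climbs to `n` in `n` steps with probability at least `(lam / (lam + mu)) ^ n`, matching the
tails as soon as the clock has passed `n + 2`. The Poisson clock runs linearly by a Chernoff bound,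
so this is eventually the case on every sublinear scale.
-/

section RandomIndex

variable {Ω ι : Type*} [MeasurableSpace Ω] [MeasurableSpace ι] [Countable ι]
  [MeasurableSingletonClass ι] {P : Measure Ω} {N : Ω → ι}

lemma lintegral_comp_eq_tsum (hN : Measurable N) (f : ι → ℝ≥0∞) :
    ∫⁻ ω, f (N ω) ∂P = ∑' i, f i * P {ω | N ω = i} := by
  rw [← lintegral_map (measurable_of_countable f) hN, lintegral_countable']
  exact tsum_congr fun i => by rw [Measure.map_apply hN (measurableSet_singleton i)]; rfl

lemma measure_eq_tsum_inter_fiber (hN : Measurable N) (A : Set Ω) :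
    P A = ∑' i, P ({ω | N ω = i} ∩ A) := by
  have h := lintegral_comp_eq_tsum (P := P.restrict A) hN 1
  simp only [Pi.one_apply, one_mul, lintegral_one, Measure.restrict_apply_univ] at h
  exact h.trans (tsum_congr fun i => Measure.restrict_apply (hN (measurableSet_singleton i)))

lemma measure_randomIndex_mem {E : Type*} [MeasurableSpace E] {X : ι → Ω → E}
    (hN : Measurable N) (hXN : ∀ i, IndepFun (X i) N P) {S : Set E} (hS : MeasurableSet S) :
    P {ω | X (N ω) ω ∈ S} = ∫⁻ ω, P {ω' | X (N ω) ω' ∈ S} ∂P := by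
  rw [lintegral_comp_eq_tsum hN fun i => P {ω' | X i ω' ∈ S}, measure_eq_tsum_inter_fiber hN]
  refine tsum_congr fun i => ?_
  have hfiber : {ω | N ω = i} ∩ {ω | X (N ω) ω ∈ S} = X i ⁻¹' S ∩ N ⁻¹' {i} := by
    ext ω
    constructor
    · rintro ⟨rfl, h⟩
      exact ⟨h, rfl⟩
    · rintro ⟨h, rfl⟩
      exact ⟨rfl, h⟩
  rw [hfiber, (hXN i).measure_inter_preimage_eq_mul S {i} hS (measurableSet_singleton i)]
  rfl

end RandomIndex

lemma mul_measure_le_lintegral {Ω : Type*} [MeasurableSpace Ω] {P : Measure Ω} {f : Ω → ℝ≥0∞}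
    (hf : Measurable f) {c : ℝ≥0∞} {A : Set Ω} (hc : ∀ ω ∈ A, c ≤ f ω) :
    c * P A ≤ ∫⁻ ω, f ω ∂P :=
  (mul_le_mul_right (measure_mono hc) c).trans (mul_meas_ge_le_lintegral hf c)

section TransitionProbabilities

variable {lam mu : ℝ}

lemma log_add_div_pos (hlam : 0 < lam) (hmu : 0 < mu) : 0 < Real.log ((lam + mu) / lam) :=
  Real.log_pos ((one_lt_div hlam).2 (by linarith : lam < lam + mu))

lemma transProb_nonneg (hlam : 0 ≤ lam) (hmu : 0 ≤ mu) (i j : ℕ) : 0 ≤ transProb lam mu i j := by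
  unfold transProb
  split_ifs <;> positivity

lemma transProb_eq_zero_of_lt {i j : ℕ} (h : i + 1 < j) : transProb lam mu i j = 0 := by
  unfold transProb
  split_ifs <;> first | rfl | omega

lemma transProb_of_lt {i j : ℕ} (h : j < i) : transProb lam mu i j = mu / (i * (lam + mu)) := by
  rw [transProb, if_neg (by omega), if_neg (by omega), if_pos h]

lemma transProb_self (i : ℕ) : transProb lam mu i i = 0 := by
  simp +contextual [transProb]

lemma transProb_succ {i : ℕ} (hi : i ≠ 0) : transProb lam mu i (i + 1) = lam / (lam + mu) := by
  simp [transProb, hi]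

lemma le_transProb_succ (hlam : 0 ≤ lam) (hmu : 0 ≤ mu) (i : ℕ) :
    lam / (lam + mu) ≤ transProb lam mu i (i + 1) := by
  rcases eq_or_ne i 0 with rfl | hi
  · simpa [transProb] using div_le_one_of_le₀ (by linarith) (by linarith)
  · exact (transProb_succ hi).ge

lemma transProb_zero_right_le (hlam : 0 ≤ lam) (hmu : 0 ≤ mu) (i : ℕ) :
    transProb lam mu i 0 ≤ mu / (lam + mu) := by
  rcases Nat.eq_zero_or_pos i with rfl | hi
  · simpa [transProb] using (by positivity : 0 ≤ mu / (lam + mu))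
  · have hi' : (1 : ℝ) ≤ i := by exact_mod_cast hi
    rw [transProb_of_lt hi, mul_comm, ← div_div]
    exact div_le_self (by positivity) hi'

/-- The transition operator `f ↦ 𝔼[f(η(k + 1)) | η(k) = ·]` of the catastrophe chain. The sum is
finite because the chain moves up by at most one. -/
noncomputable def transOp (lam mu : ℝ) (f : ℕ → ℝ) (i : ℕ) : ℝ :=
  ∑ j ∈ Finset.range (i + 2), transProb lam mu i j * f j

lemma transOp_eq_of_ne_zero (f : ℕ → ℝ) {i : ℕ} (hi : i ≠ 0) :
    transOp lam mu f i
      = mu / (i * (lam + mu)) * ∑ j ∈ Finset.range i, f j + lam / (lam + mu) * f (i + 1) := by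
  have hlow : ∑ j ∈ Finset.range i, transProb lam mu i j * f j
      = mu / (i * (lam + mu)) * ∑ j ∈ Finset.range i, f j := by
    rw [Finset.mul_sum]
    exact Finset.sum_congr rfl fun j hj => by rw [transProb_of_lt (Finset.mem_range.1 hj)]
  rw [transOp, Finset.sum_range_succ, Finset.sum_range_succ, transProb_self, transProb_succ hi,
    hlow, zero_mul, add_zero]

lemma tsum_ofReal_transProb_mul (hlam : 0 ≤ lam) (hmu : 0 ≤ mu) {f : ℕ → ℝ} (hf : ∀ j, 0 ≤ f j)
    (i : ℕ) :
    ∑' j, ENNReal.ofReal (f j) * ENNReal.ofReal (transProb lam mu i j)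
      = ENNReal.ofReal (transOp lam mu f i) := by
  have hp := transProb_nonneg hlam hmu i
  simp_rw [mul_comm (ENNReal.ofReal (f _)), ← ENNReal.ofReal_mul (hp _)]
  rw [transOp, ENNReal.ofReal_sum_of_nonneg fun j _ => mul_nonneg (hp j) (hf j)]
  refine tsum_eq_sum fun j hj => ?_
  rw [transProb_eq_zero_of_lt (by simpa [Nat.succ_le_iff] using hj), zero_mul, ENNReal.ofReal_zero]

lemma transOp_pow_le (hlam : 0 < lam) (hmu : 0 ≤ mu) {z : ℝ} (hz : 1 < z) {i : ℕ} (hi : i ≠ 0) :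
    transOp lam mu (z ^ ·) i ≤ (1 / (z - 1) / i + lam / (lam + mu) * z) * z ^ i := by
  have hz' : 0 < z - 1 := by linarith
  have hmu' : mu / (lam + mu) ≤ 1 := div_le_one_of_le₀ (by linarith) (by linarith)
  have hi' : (0 : ℝ) < i := by positivity
  have hgeom : mu / (i * (lam + mu)) * ∑ j ∈ Finset.range i, z ^ j
      ≤ 1 / (z - 1) / i * z ^ i := by
    calc mu / (i * (lam + mu)) * ∑ j ∈ Finset.range i, z ^ j
        = mu / (lam + mu) * ((z ^ i - 1) / (z - 1) / i) := by
          rw [geom_sum_eq hz.ne']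
          field_simp
      _ ≤ 1 * (z ^ i / (z - 1) / i) := by
          gcongr
          · exact div_nonneg
              (div_nonneg (by linarith [one_le_pow₀ (n := i) hz.le]) hz'.le) hi'.le
          · linarith
      _ = 1 / (z - 1) / i * z ^ i := by ring
  rw [transOp_eq_of_ne_zero _ hi, add_mul, pow_succ]
  linarith

lemma exists_transOp_pow_le_mul_add (hlam : 0 < lam) (hmu : 0 ≤ mu) {z : ℝ} (hz : 1 < z)
    (hz' : lam / (lam + mu) * z < 1) :
    ∃ ρ K : ℝ, 0 ≤ ρ ∧ ρ < 1 ∧ 0 ≤ K ∧ ∀ i, transOp lam mu (z ^ ·) i ≤ ρ * z ^ i + K := by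
  obtain ⟨ρ, hzρ, hρ⟩ := exists_between hz'
  have hρ0 : 0 ≤ ρ := le_trans (by positivity) hzρ.le
  have hlim : Tendsto (fun i : ℕ => 1 / (z - 1) / i + lam / (lam + mu) * z) atTop
      (𝓝 (lam / (lam + mu) * z)) := by
    simpa using (tendsto_const_div_atTop_nhds_zero_nat (1 / (z - 1))).add_const
      (lam / (lam + mu) * z)
  obtain ⟨M, hM⟩ := eventually_atTop.1 ((hlim.eventually (ge_mem_nhds hzρ)).and
    (eventually_ne_atTop 0))
  refine ⟨ρ, ∑ i ∈ Finset.range M, |transOp lam mu (z ^ ·) i|, hρ0, hρ, by positivity, fun i => ?_⟩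
  have hK : 0 ≤ ∑ i ∈ Finset.range M, |transOp lam mu (z ^ ·) i| := by positivity
  rcases lt_or_ge i M with hi | hi
  · calc transOp lam mu (z ^ ·) i ≤ |transOp lam mu (z ^ ·) i| := le_abs_self _
      _ ≤ ∑ i ∈ Finset.range M, |transOp lam mu (z ^ ·) i| :=
          Finset.single_le_sum (f := fun i => |transOp lam mu (z ^ ·) i|)
            (fun _ _ => abs_nonneg _) (Finset.mem_range.2 hi)
      _ ≤ ρ * z ^ i + ∑ i ∈ Finset.range M, |transOp lam mu (z ^ ·) i| :=
          le_add_of_nonneg_left (by positivity)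
  · calc transOp lam mu (z ^ ·) i ≤ (1 / (z - 1) / i + lam / (lam + mu) * z) * z ^ i :=
          transOp_pow_le hlam hmu hz (hM i hi).2
      _ ≤ ρ * z ^ i := by
          gcongr
          exact (hM i hi).1
      _ ≤ ρ * z ^ i + ∑ i ∈ Finset.range M, |transOp lam mu (z ^ ·) i| :=
          le_add_of_nonneg_right hK

end TransitionProbabilities

namespace IsCatastropheChain

variable {Ω : Type*} [MeasurableSpace Ω] {P : Measure Ω} {lam mu : ℝ} {η : ℕ → Ω → ℕ}

lemma measure_history_inter [IsFiniteMeasure P] (hη : IsCatastropheChain P lam mu η) (k j : ℕ)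
    (x : ℕ → ℕ) :
    P ({ω | ∀ m ≤ k, η m ω = x m} ∩ {ω | η (k + 1) ω = j})
      = ENNReal.ofReal (transProb lam mu (x k) j) * P {ω | ∀ m ≤ k, η m ω = x m} := by
  have hx : MeasurableSet {ω | ∀ m ≤ k, η m ω = x m} := by
    simp only [Set.ofPred_forall]
    exact MeasurableSet.iInter fun m => MeasurableSet.iInter fun _ =>
      hη.measurable m (measurableSet_singleton (x m))
  rcases eq_or_ne (P {ω | ∀ m ≤ k, η m ω = x m}) 0 with h0 | h0
  · rw [h0, mul_zero]
    exact measure_mono_null Set.inter_subset_left h0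
  · rw [← hη.markov k x j h0, cond_mul_eq_inter hx]

lemma measure_succ_eq [IsFiniteMeasure P] (hη : IsCatastropheChain P lam mu η) (k j : ℕ) :
    P {ω | η (k + 1) ω = j} = ∫⁻ ω, ENNReal.ofReal (transProb lam mu (η k ω) j) ∂P := by
  have hhist : Measurable fun ω (m : Set.Iic k) => η m ω :=
    measurable_pi_lambda _ fun m => hη.measurable m
  rw [lintegral_comp_eq_tsum hhist
    fun h => ENNReal.ofReal (transProb lam mu (h ⟨k, Set.mem_Iic.2 le_rfl⟩) j),
    measure_eq_tsum_inter_fiber hhist]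
  refine tsum_congr fun h => ?_
  rcases Set.eq_empty_or_nonempty {ω | (fun m : Set.Iic k => η m ω) = h} with hh | ⟨ω₀, rfl⟩
  · simp [hh]
  · have hfiber : {ω | (fun m : Set.Iic k => η m ω) = fun m : Set.Iic k => η m ω₀}
        = {ω | ∀ m ≤ k, η m ω = η m ω₀} := by
      ext ω
      simp [funext_iff]
    rw [hfiber, hη.measure_history_inter k j fun m => η m ω₀]

lemma lintegral_ofReal_succ [IsFiniteMeasure P] (hη : IsCatastropheChain P lam mu η)
    (hlam : 0 ≤ lam) (hmu : 0 ≤ mu) {f : ℕ → ℝ} (hf : ∀ j, 0 ≤ f j) (k : ℕ) :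
    ∫⁻ ω, ENNReal.ofReal (f (η (k + 1) ω)) ∂P
      = ∫⁻ ω, ENNReal.ofReal (transOp lam mu f (η k ω)) ∂P := by
  have hmeas : ∀ g : ℕ → ℝ≥0∞, Measurable fun ω => g (η k ω) := fun g =>
    (measurable_of_countable g).comp (hη.measurable k)
  have hterm : ∀ j, Measurable fun ω => ENNReal.ofReal (transProb lam mu (η k ω) j) := fun j =>
    hmeas fun i => ENNReal.ofReal (transProb lam mu i j)
  simp_rw [← tsum_ofReal_transProb_mul hlam hmu hf]
  rw [lintegral_tsum fun j => ((hterm j).const_mul _).aemeasurable,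
    lintegral_comp_eq_tsum (hη.measurable (k + 1)) fun j => ENNReal.ofReal (f j)]
  exact tsum_congr fun j => by rw [hη.measure_succ_eq, lintegral_const_mul _ (hterm j)]

lemma mul_measure_le_measure_succ [IsFiniteMeasure P] (hη : IsCatastropheChain P lam mu η)
    (k j : ℕ) {S : Set ℕ} {p : ℝ} (hp : ∀ i ∈ S, p ≤ transProb lam mu i j) :
    ENNReal.ofReal p * P {ω | η k ω ∈ S} ≤ P {ω | η (k + 1) ω = j} := by
  rw [hη.measure_succ_eq]
  exact mul_measure_le_lintegral
    ((measurable_of_countable fun i => ENNReal.ofReal (transProb lam mu i j)).comp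
      (hη.measurable k)) fun ω hω => ENNReal.ofReal_le_ofReal (hp _ hω)

variable [IsProbabilityMeasure P]

lemma lintegral_ofReal_le_of_transOp_le (hη : IsCatastropheChain P lam mu η) (hlam : 0 ≤ lam)
    (hmu : 0 ≤ mu) {V : ℕ → ℝ} (hV : ∀ i, 0 ≤ V i) {ρ K : ℝ} (hρ : 0 ≤ ρ) (hρ1 : ρ < 1)
    (hK : 0 ≤ K) (hdrift : ∀ i, transOp lam mu V i ≤ ρ * V i + K) (k : ℕ) :
    ∫⁻ ω, ENNReal.ofReal (V (η k ω)) ∂P ≤ ENNReal.ofReal (V 0 + K / (1 - ρ)) := by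
  have hρ' : 0 < 1 - ρ := by linarith
  have hfix : ρ * (V 0 + K / (1 - ρ)) + K ≤ V 0 + K / (1 - ρ) := by
    have hK' : K / (1 - ρ) * (1 - ρ) = K := div_mul_cancel₀ K hρ'.ne'
    nlinarith [mul_nonneg (hV 0) hρ'.le]
  have hC : 0 ≤ V 0 + K / (1 - ρ) := add_nonneg (hV 0) (by positivity)
  induction k with
  | zero =>
    calc ∫⁻ ω, ENNReal.ofReal (V (η 0 ω)) ∂P = ∫⁻ _, ENNReal.ofReal (V 0) ∂P :=
          lintegral_congr_ae (hη.init.mono fun ω hω => by simp only [hω])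
      _ = ENNReal.ofReal (V 0) := by simp
      _ ≤ ENNReal.ofReal (V 0 + K / (1 - ρ)) :=
          ENNReal.ofReal_le_ofReal (le_add_of_nonneg_right (by positivity))
  | succ k ih =>
    have hVmeas : Measurable fun ω => ENNReal.ofReal (V (η k ω)) :=
      (measurable_of_countable fun i => ENNReal.ofReal (V i)).comp (hη.measurable k)
    calc ∫⁻ ω, ENNReal.ofReal (V (η (k + 1) ω)) ∂P
        = ∫⁻ ω, ENNReal.ofReal (transOp lam mu V (η k ω)) ∂P :=
          hη.lintegral_ofReal_succ hlam hmu hV k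
      _ ≤ ∫⁻ ω, (ENNReal.ofReal ρ * ENNReal.ofReal (V (η k ω)) + ENNReal.ofReal K) ∂P := by
          gcongr with ω
          rw [← ENNReal.ofReal_mul hρ, ← ENNReal.ofReal_add (mul_nonneg hρ (hV _)) hK]
          exact ENNReal.ofReal_le_ofReal (hdrift _)
      _ = ENNReal.ofReal ρ * ∫⁻ ω, ENNReal.ofReal (V (η k ω)) ∂P + ENNReal.ofReal K := by
          rw [lintegral_add_right _ measurable_const, lintegral_const_mul _ hVmeas,
            lintegral_const, measure_univ, mul_one]
      _ ≤ ENNReal.ofReal ρ * ENNReal.ofReal (V 0 + K / (1 - ρ)) + ENNReal.ofReal K := by gcongr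
      _ = ENNReal.ofReal (ρ * (V 0 + K / (1 - ρ)) + K) := by
          rw [← ENNReal.ofReal_mul hρ, ← ENNReal.ofReal_add (mul_nonneg hρ hC) hK]
      _ ≤ ENNReal.ofReal (V 0 + K / (1 - ρ)) := ENNReal.ofReal_le_ofReal hfix

lemma exists_measure_ge_le_exp (hη : IsCatastropheChain P lam mu η) (hlam : 0 < lam)
    (hmu : 0 ≤ mu) {s : ℝ} (hs : 0 < s) (hs' : s < Real.log ((lam + mu) / lam)) :
    ∃ C : ℝ, 0 < C ∧ ∀ k (x : ℝ),
      P {ω | x ≤ η k ω} ≤ ENNReal.ofReal (C * Real.exp (-(s * x))) := by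
  have hz' : lam / (lam + mu) * Real.exp s < 1 := by
    rw [← inv_div, inv_mul_lt_one₀ (by positivity)]
    exact (Real.lt_log_iff_exp_lt (by positivity)).1 hs'
  obtain ⟨ρ, K, hρ, hρ1, hK, hdrift⟩ :=
    exists_transOp_pow_le_mul_add hlam hmu (Real.one_lt_exp_iff.2 hs) hz'
  have hC : 0 < 1 + K / (1 - ρ) := by
    have : 0 < 1 - ρ := by linarith
    positivity
  refine ⟨_, hC, fun k x => ?_⟩
  have hmeas : Measurable fun ω => ENNReal.ofReal (Real.exp s ^ η k ω) :=
    (measurable_of_countable fun i : ℕ => ENNReal.ofReal (Real.exp s ^ i)).comp (hη.measurable k)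
  have hmarkov : ENNReal.ofReal (Real.exp (s * x)) * P {ω | x ≤ η k ω}
      ≤ ENNReal.ofReal (1 + K / (1 - ρ)) := by
    calc ENNReal.ofReal (Real.exp (s * x)) * P {ω | x ≤ η k ω}
        ≤ ∫⁻ ω, ENNReal.ofReal (Real.exp s ^ η k ω) ∂P :=
          mul_measure_le_lintegral hmeas fun ω hω => by
            rw [← Real.exp_nat_mul, mul_comm _ s]
            have hω : x ≤ η k ω := hω
            gcongr
      _ ≤ ENNReal.ofReal (1 + K / (1 - ρ)) := by
          simpa only [pow_zero] using hη.lintegral_ofReal_le_of_transOp_le hlam.le hmu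
            (fun i => (by positivity : 0 ≤ Real.exp s ^ i)) hρ hρ1 hK hdrift k
  rw [ENNReal.ofReal_mul hC.le, Real.exp_neg, ENNReal.ofReal_inv_of_pos (Real.exp_pos _),
    ← div_eq_mul_inv, ENNReal.le_div_iff_mul_le (by simp [Real.exp_pos]) (by simp), mul_comm]
  exact hmarkov

lemma exists_measure_ge_le (hη : IsCatastropheChain P lam mu η) (hlam : 0 < lam) (hmu : 0 < mu)
    {ε : ℝ} (hε : 0 < ε) : ∃ M : ℕ, ∀ k, P {ω | M ≤ η k ω} ≤ ENNReal.ofReal ε := by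
  obtain ⟨s, hs, hs'⟩ := exists_between (log_add_div_pos hlam hmu)
  obtain ⟨C, -, hC⟩ := hη.exists_measure_ge_le_exp hlam hmu.le hs hs'
  have hlim : Tendsto (fun M : ℕ => C * Real.exp (-(s * M))) atTop (𝓝 0) := by
    simpa using (Real.tendsto_exp_neg_atTop_nhds_zero.comp
      (tendsto_natCast_atTop_atTop.const_mul_atTop hs)).const_mul C
  obtain ⟨M, hM⟩ := (hlim.eventually (ge_mem_nhds hε)).exists
  exact ⟨M, fun k => by
    simpa only [Nat.cast_le] using (hC k M).trans (ENNReal.ofReal_le_ofReal hM)⟩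

lemma measure_succ_eq_zero_le (hη : IsCatastropheChain P lam mu η) (hlam : 0 ≤ lam)
    (hmu : 0 ≤ mu) (k : ℕ) :
    P {ω | η (k + 1) ω = 0} ≤ ENNReal.ofReal (mu / (lam + mu)) := by
  rw [hη.measure_succ_eq]
  calc ∫⁻ ω, ENNReal.ofReal (transProb lam mu (η k ω) 0) ∂P
      ≤ ∫⁻ _, ENNReal.ofReal (mu / (lam + mu)) ∂P := by
        gcongr with ω
        exact transProb_zero_right_le hlam hmu _
    _ = ENNReal.ofReal (mu / (lam + mu)) := by simp

lemma exists_le_measure_succ_mem_Ioo (hη : IsCatastropheChain P lam mu η) (hlam : 0 < lam)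
    (hmu : 0 < mu) : ∃ (M : ℕ) (c : ℝ), 0 < c ∧
      ∀ k, ENNReal.ofReal c ≤ P {ω | η (k + 1) ω ∈ Set.Ioo 0 M} := by
  have hp : 0 < lam / (lam + mu) := by positivity
  have hpq : lam / (lam + mu) + mu / (lam + mu) = 1 := by field_simp
  obtain ⟨M, hM⟩ := hη.exists_measure_ge_le hlam hmu (half_pos hp)
  refine ⟨M, lam / (lam + mu) / 2, half_pos hp, fun k => ?_⟩
  have hcover : 1 ≤ P {ω | η (k + 1) ω ∈ Set.Ioo 0 M}
      + ENNReal.ofReal (mu / (lam + mu) + lam / (lam + mu) / 2) := by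
    calc 1 = P Set.univ := measure_univ.symm
      _ ≤ P ({ω | η (k + 1) ω ∈ Set.Ioo 0 M} ∪
            ({ω | η (k + 1) ω = 0} ∪ {ω | M ≤ η (k + 1) ω})) := measure_mono fun ω _ => by
          simp only [Set.mem_union, Set.mem_ofPred_eq, Set.mem_Ioo]
          omega
      _ ≤ P {ω | η (k + 1) ω ∈ Set.Ioo 0 M}
            + (ENNReal.ofReal (mu / (lam + mu)) + ENNReal.ofReal (lam / (lam + mu) / 2)) := by
          refine (measure_union_le _ _).trans ?_
          gcongr
          exact (measure_union_le _ _).trans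
            (add_le_add (hη.measure_succ_eq_zero_le hlam.le hmu.le k) (hM (k + 1)))
      _ = _ := by rw [ENNReal.ofReal_add (by positivity) (by positivity)]
  calc ENNReal.ofReal (lam / (lam + mu) / 2)
      = 1 - ENNReal.ofReal (mu / (lam + mu) + lam / (lam + mu) / 2) := by
        rw [← ENNReal.ofReal_one, ← ENNReal.ofReal_sub _ (by positivity)]
        congr 1
        linarith
    _ ≤ P {ω | η (k + 1) ω ∈ Set.Ioo 0 M} := tsub_le_iff_right.2 hcover

lemma exists_le_measure_add_two_eq_zero (hη : IsCatastropheChain P lam mu η) (hlam : 0 < lam)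
    (hmu : 0 < mu) : ∃ c : ℝ, 0 < c ∧ ∀ k, ENNReal.ofReal c ≤ P {ω | η (k + 2) ω = 0} := by
  obtain ⟨M, c, hc, hM⟩ := hη.exists_le_measure_succ_mem_Ioo hlam hmu
  refine ⟨mu / ((M + 1) * (lam + mu)) * c, by positivity, fun k => ?_⟩
  have hjump : ∀ i ∈ Set.Ioo 0 M, mu / ((M + 1) * (lam + mu)) ≤ transProb lam mu i 0 := by
    rintro i ⟨hi, hiM⟩
    have hiM' : (i : ℝ) ≤ M + 1 := by exact_mod_cast hiM.le.trans M.le_succ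
    rw [transProb_of_lt hi]
    gcongr
  rw [ENNReal.ofReal_mul (by positivity)]
  exact (mul_le_mul_right (hM k) _).trans (hη.mul_measure_le_measure_succ (k + 1) 0 hjump)

lemma exists_le_measure_eq (hη : IsCatastropheChain P lam mu η) (hlam : 0 < lam) (hmu : 0 < mu) :
    ∃ c : ℝ, 0 < c ∧ ∀ n k, n + 2 ≤ k →
      ENNReal.ofReal (c * (lam / (lam + mu)) ^ n) ≤ P {ω | η k ω = n} := by
  obtain ⟨c, hc, hzero⟩ := hη.exists_le_measure_add_two_eq_zero hlam hmu
  refine ⟨c, hc, fun n => ?_⟩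
  induction n with
  | zero =>
    intro k hk
    obtain ⟨k, rfl⟩ := Nat.exists_eq_add_of_le' hk
    simpa using hzero k
  | succ n ih =>
    intro k hk
    obtain ⟨k, rfl⟩ := Nat.exists_eq_add_of_le' (by omega : 1 ≤ k)
    have hclimb : ∀ i ∈ ({n} : Set ℕ), lam / (lam + mu) ≤ transProb lam mu i (n + 1) := by
      rintro i rfl
      exact le_transProb_succ hlam.le hmu.le i
    rw [pow_succ', mul_left_comm, ENNReal.ofReal_mul (by positivity)]
    exact (mul_le_mul_right (ih k (by omega)) _).trans
      (hη.mul_measure_le_measure_succ k (n + 1) hclimb)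

end IsCatastropheChain

lemma hasSum_exp_mul_poissonMeasure (r : ℝ≥0) (t : ℝ) :
    HasSum (fun n : ℕ => Real.exp (-r) * r ^ n / n.factorial * Real.exp (t * n))
      (Real.exp (r * (Real.exp t - 1))) := by
  convert! (NormedSpace.expSeries_div_hasSum_exp (r * Real.exp t)).mul_left (Real.exp (-r)) using 1
  · ext n
    rw [mul_pow, ← Real.exp_nat_mul, mul_comm t]
    ring
  · rw [← Real.exp_eq_exp_ℝ, ← Real.exp_add]
    ring_nf

lemma integrable_exp_mul_poissonMeasure (r : ℝ≥0) (t : ℝ) :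
    Integrable (fun n : ℕ => Real.exp (t * n)) (poissonMeasure r) := by
  rw [integrable_poissonMeasure_iff]
  simpa only [Real.norm_eq_abs, Real.abs_exp] using (hasSum_exp_mul_poissonMeasure r t).summable

lemma mgf_poissonMeasure (r : ℝ≥0) (t : ℝ) :
    mgf (fun n : ℕ => (n : ℝ)) (poissonMeasure r) t = Real.exp (r * (Real.exp t - 1)) := by
  rw [mgf, integral_poissonMeasure]
  exact (hasSum_exp_mul_poissonMeasure r t).tsum_eq

lemma poissonMeasure_real_le_le_exp (r : ℝ≥0) (x : ℝ) :
    (poissonMeasure r).real {n : ℕ | (n : ℝ) ≤ x} ≤ Real.exp (x - r / 2) := by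
  have hexp : Real.exp (-1) ≤ 1 / 2 := by
    rw [Real.exp_neg, one_div]
    exact inv_anti₀ (by norm_num) (by linarith [Real.add_one_le_exp 1])
  calc (poissonMeasure r).real {n : ℕ | (n : ℝ) ≤ x}
      ≤ Real.exp (-(-1) * x) * mgf (fun n : ℕ => (n : ℝ)) (poissonMeasure r) (-1) :=
        measure_le_le_exp_mul_mgf x (by norm_num) (integrable_exp_mul_poissonMeasure r (-1))
    _ = Real.exp (x + r * (Real.exp (-1) - 1)) := by
        rw [mgf_poissonMeasure, ← Real.exp_add, neg_neg, one_mul]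
    _ ≤ Real.exp (x - r / 2) := Real.exp_le_exp.2 (by nlinarith [r.coe_nonneg])

namespace IsPoissonProcess

variable {Ω : Type*} [MeasurableSpace Ω] {P : Measure Ω} {α : ℝ≥0} {ν : ℝ≥0 → Ω → ℕ}

lemma hasLaw (hν : IsPoissonProcess P α ν) (t : ℝ≥0) :
    HasLaw (ν t) (poissonMeasure (α * t)) P := by
  have h := hν.law_increments 0 t zero_le
  rw [tsub_zero] at h
  exact h.congr (hν.init.mono fun ω hω => by simp only [hω, tsub_zero])

lemma tendsto_measure_lt_zero (hν : IsPoissonProcess P α ν) (hα : 0 < α) {f : ℝ≥0 → ℝ}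
    (hf : Tendsto (fun t : ℝ≥0 => f t / t) atTop (𝓝 0)) :
    Tendsto (fun t => P {ω | (ν t ω : ℝ) < f t}) atTop (𝓝 0) := by
  have hα' : (0 : ℝ) < α / 4 := div_pos (NNReal.coe_pos.2 hα) four_pos
  have hbound : Tendsto (fun t : ℝ≥0 => ENNReal.ofReal (Real.exp (-(α / 4 * t)))) atTop (𝓝 0) := by
    simpa using ENNReal.tendsto_ofReal (Real.tendsto_exp_neg_atTop_nhds_zero.comp
      ((NNReal.tendsto_coe_atTop.2 tendsto_id).const_mul_atTop hα'))
  refine tendsto_of_tendsto_of_tendsto_of_le_of_le' tendsto_const_nhds hbound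
    (Eventually.of_forall fun _ => zero_le) ?_
  filter_upwards [hf.eventually (ge_mem_nhds hα'),
    eventually_gt_atTop 0] with t hft ht
  rw [div_le_iff₀ (NNReal.coe_pos.2 ht)] at hft
  calc P {ω | (ν t ω : ℝ) < f t} ≤ P {ω | (ν t ω : ℝ) ≤ f t} :=
        measure_mono fun ω (hω : (ν t ω : ℝ) < f t) => hω.le
    _ = ENNReal.ofReal ((poissonMeasure (α * t)).real {n : ℕ | (n : ℝ) ≤ f t}) := by
        rw [(hν.hasLaw t).measure_eq (p := fun n : ℕ => (n : ℝ) ≤ f t) MeasurableSet.of_discrete,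
          ofReal_measureReal]
    _ ≤ ENNReal.ofReal (Real.exp (f t - (α * t : ℝ≥0) / 2)) :=
        ENNReal.ofReal_le_ofReal (poissonMeasure_real_le_le_exp _ _)
    _ ≤ ENNReal.ofReal (Real.exp (-(α / 4 * t))) := by
        refine ENNReal.ofReal_le_ofReal (Real.exp_le_exp.2 ?_)
        push_cast
        linarith

end IsPoissonProcess

section NormalizedLog

variable {ι : Type*} {L : Filter ι} {ψ : ι → ℝ} {Q : ι → ℝ≥0∞}

/-- The logarithm of `Q` on the scale `ψ`, the quantity whose upper and lower limits a large
deviation principle with normalizing function `ψ` controls. It takes the value `-∞` where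
`Q = 0` and `ψ > 0`. -/
noncomputable def normalizedLog (ψ : ι → ℝ) (Q : ι → ℝ≥0∞) (T : ι) : EReal :=
  ((1 / ψ T : ℝ) : EReal) * ENNReal.log (Q T)

lemma normalizedLog_le_normalizedLog {Q' : ι → ℝ≥0∞} {T : ι} (hψ : 0 < ψ T) (hQ : Q T ≤ Q' T) :
    normalizedLog ψ Q T ≤ normalizedLog ψ Q' T :=
  mul_le_mul_of_nonneg_left (ENNReal.log_le_log hQ) (EReal.coe_nonneg.2 (by positivity))

lemma tendsto_normalizedLog_const_mul_exp (hψ : Tendsto ψ L atTop) {C r : ℝ} (hC : 0 < C)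
    {g : ι → ℝ} (hg : Tendsto (fun T => g T / ψ T) L (𝓝 r)) :
    Tendsto (normalizedLog ψ fun T => ENNReal.ofReal (C * Real.exp (g T))) L (𝓝 (r : EReal)) := by
  have hlim : Tendsto (fun T => ((Real.log C / ψ T + g T / ψ T : ℝ) : EReal)) L
      (𝓝 (r : EReal)) := by
    rw [EReal.tendsto_coe]
    simpa using (hψ.const_div_atTop (Real.log C)).add hg
  refine hlim.congr fun T => ?_
  rw [normalizedLog, ENNReal.log_ofReal_of_pos (by positivity),
    Real.log_mul hC.ne' (Real.exp_pos _).ne', Real.log_exp, ← EReal.coe_mul]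
  congr 1
  ring

variable [L.NeBot]

lemma limsup_normalizedLog_le (hψ : Tendsto ψ L atTop) {C r : ℝ} (hC : 0 < C) {g : ι → ℝ}
    (hg : Tendsto (fun T => g T / ψ T) L (𝓝 r))
    (hQ : ∀ᶠ T in L, Q T ≤ ENNReal.ofReal (C * Real.exp (g T))) :
    limsup (normalizedLog ψ Q) L ≤ r := by
  rw [← (tendsto_normalizedLog_const_mul_exp hψ hC hg).limsup_eq]
  refine limsup_le_limsup ?_
  filter_upwards [hQ, hψ.eventually_gt_atTop 0] with T hQT hψT
  exact normalizedLog_le_normalizedLog hψT hQT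

lemma le_liminf_normalizedLog (hψ : Tendsto ψ L atTop) {C r : ℝ} (hC : 0 < C) {g : ι → ℝ}
    (hg : Tendsto (fun T => g T / ψ T) L (𝓝 r))
    (hQ : ∀ᶠ T in L, ENNReal.ofReal (C * Real.exp (g T)) ≤ Q T) :
    r ≤ liminf (normalizedLog ψ Q) L := by
  rw [← (tendsto_normalizedLog_const_mul_exp hψ hC hg).liminf_eq]
  refine liminf_le_liminf ?_
  filter_upwards [hQ, hψ.eventually_gt_atTop 0] with T hQT hψT
  exact normalizedLog_le_normalizedLog hψT hQT

end NormalizedLog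

lemma neg_iInf_coe_le {E : Type*} {I : E → ℝ≥0∞} {S : Set E} {b : EReal}
    (h : ∀ x ∈ S, -(I x : EReal) ≤ b) : -((⨅ x ∈ S, I x : ℝ≥0∞) : EReal) ≤ b := by
  rw [EReal.neg_le]
  calc -b ≤ ((-b).toENNReal : EReal) := EReal.coe_toENNReal_eq_max ▸ le_max_right 0 (-b)
    _ ≤ ((⨅ x ∈ S, I x : ℝ≥0∞) : EReal) := by
      rw [EReal.coe_ennreal_le_coe_ennreal_iff]
      refine le_iInf₂ fun x hx => ?_
      rw [← EReal.toENNReal_coe (x := I x)]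
      exact EReal.toENNReal_le_toENNReal (EReal.neg_le.1 (h x hx))

section ExponentialRate

/-- The rate function `x ↦ l x` of an exponential law, infinite on the negative half-line;
`rateI₁ lam mu` is the case `l = log ((lam + mu) / lam)`. -/
noncomputable def exponentialRate (l x : ℝ) : ℝ≥0∞ :=
  if x < 0 then ⊤ else ENNReal.ofReal (x * l)

variable {l x y : ℝ}

lemma exponentialRate_of_nonneg (hx : 0 ≤ x) : exponentialRate l x = ENNReal.ofReal (x * l) :=
  if_neg hx.not_gt

lemma nonneg_of_exponentialRate_ne_top (h : exponentialRate l x ≠ ⊤) : 0 ≤ x :=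
  not_lt.1 fun hx => h (if_pos hx)

lemma isCompact_exponentialRate_le (hl : 0 < l) (c : ℝ≥0) :
    IsCompact {x | exponentialRate l x ≤ c} := by
  have hIcc : {x | exponentialRate l x ≤ c} = Set.Icc 0 (c / l) := by
    ext x
    rw [Set.mem_ofPred_eq, Set.mem_Icc, le_div_iff₀ hl, ← Real.toNNReal_le_iff_le_coe]
    constructor
    · intro h
      have hx := nonneg_of_exponentialRate_ne_top (h.trans_lt ENNReal.coe_lt_top).ne
      rw [exponentialRate_of_nonneg hx] at h
      exact ⟨hx, ENNReal.coe_le_coe.1 h⟩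
    · rintro ⟨hx, h⟩
      rw [exponentialRate_of_nonneg hx]
      exact ENNReal.coe_le_coe.2 h
  exact hIcc ▸ isCompact_Icc

variable {Ω : Type*} [MeasurableSpace Ω] {P : Measure Ω} {X : ℝ≥0 → Ω → ℝ} {ψ : ℝ≥0 → ℝ}

lemma limsup_normalizedLog_mem_le (hl : 0 < l) (hψ : Tendsto ψ atTop atTop)
    (hX : ∀ᶠ T in atTop, ∀ ω, 0 ≤ X T ω)
    (htail : ∀ x, 0 ≤ x →
      limsup (normalizedLog ψ fun T => P {ω | x ≤ X T ω}) atTop ≤ ((-(x * l) : ℝ) : EReal))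
    (B : Set ℝ) :
    limsup (normalizedLog ψ fun T => P {ω | X T ω ∈ B}) atTop
      ≤ -((⨅ x ∈ closure B, exponentialRate l x : ℝ≥0∞) : EReal) := by
  refine EReal.le_of_forall_lt_iff_le.1 fun z hz => ?_
  set y := max (-z) 0 / l
  have hyl : y * l = max (-z) 0 := div_mul_cancel₀ _ hl.ne'
  have hy : 0 ≤ y := by positivity
  have hyB : ∀ x ∈ B, 0 ≤ x → y ≤ x := fun x hxB hx => by
    have hinf : (⨅ x ∈ closure B, exponentialRate l x) ≤ ENNReal.ofReal (x * l) :=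
      exponentialRate_of_nonneg (l := l) hx ▸ iInf₂_le x (subset_closure hxB)
    have hzx : ((-(x * l) : ℝ) : EReal) < z := by
      refine lt_of_le_of_lt ?_ hz
      rw [← EReal.coe_ennreal_le_coe_ennreal_iff, EReal.coe_ennreal_ofReal,
        max_eq_left (by positivity)] at hinf
      exact EReal.neg_le_neg_iff.2 hinf
    rw [div_le_iff₀ hl]
    exact max_le (by linarith [EReal.coe_lt_coe_iff.1 hzx]) (by positivity)
  calc limsup (normalizedLog ψ fun T => P {ω | X T ω ∈ B}) atTop
      ≤ limsup (normalizedLog ψ fun T => P {ω | y ≤ X T ω}) atTop := by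
        refine limsup_le_limsup ?_
        filter_upwards [hX, hψ.eventually_gt_atTop 0] with T hXT hψT
        exact normalizedLog_le_normalizedLog hψT
          (measure_mono fun ω hω => hyB _ hω (hXT ω))
    _ ≤ ((-(y * l) : ℝ) : EReal) := htail y hy
    _ ≤ z := by
        rw [hyl, EReal.coe_le_coe_iff]
        linarith [le_max_left (-z) 0]

lemma satisfiesLDP_exponentialRate (hl : 0 < l) (hψ : Tendsto ψ atTop atTop)
    (hX : ∀ᶠ T in atTop, ∀ ω, 0 ≤ X T ω)
    (htail : ∀ x, 0 ≤ x →
      limsup (normalizedLog ψ fun T => P {ω | x ≤ X T ω}) atTop ≤ ((-(x * l) : ℝ) : EReal))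
    (hlocal : ∀ x, 0 ≤ x → ∀ U ∈ 𝓝 x,
      ((-(x * l) : ℝ) : EReal) ≤ liminf (normalizedLog ψ fun T => P {ω | X T ω ∈ U}) atTop) :
    SatisfiesLDP P X ψ (exponentialRate l) where
  tendsto_normalization := hψ
  isCompact_sublevel := isCompact_exponentialRate_le hl
  upper_bound B _ := limsup_normalizedLog_mem_le hl hψ hX htail B
  lower_bound B _ := neg_iInf_coe_le fun x hxB => by
    rcases lt_or_ge x 0 with hx | hx
    · simp [exponentialRate, hx]
    · rw [exponentialRate_of_nonneg hx, EReal.coe_ennreal_ofReal, max_eq_left (by positivity)]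
      exact hlocal x hx B (mem_interior_iff_mem_nhds.1 hxB)

end ExponentialRate

lemma eventually_half_le_measure_ceil_add_two_le {Ω ι : Type*} [MeasurableSpace Ω] {P : Measure Ω}
    [IsProbabilityMeasure P] {L : Filter ι} {ν : ι → Ω → ℕ} {ψ : ι → ℝ}
    (hψ : Tendsto ψ L atTop)
    (hνψ : ∀ x : ℝ, Tendsto (fun T => P {ω | (ν T ω : ℝ) < x * ψ T}) L (𝓝 0))
    {x : ℝ} (hx : 0 ≤ x) :
    ∀ᶠ T in L, ENNReal.ofReal (1 / 2) ≤ P {ω | ⌈x * ψ T⌉₊ + 2 ≤ ν T ω} := by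
  filter_upwards [hψ.eventually_ge_atTop 3,
    (hνψ (x + 1)).eventually (ge_mem_nhds (by norm_num : (0 : ℝ≥0∞) < 1 / 2))] with T hψT hνT
  have hceil : (⌈x * ψ T⌉₊ : ℝ) + 2 ≤ (x + 1) * ψ T := by
    linarith [Nat.ceil_lt_add_one (by positivity : 0 ≤ x * ψ T)]
  have hlate : P {ω | ⌈x * ψ T⌉₊ + 2 ≤ ν T ω}ᶜ ≤ 1 / 2 := by
    refine (measure_mono fun ω hω => ?_).trans hνT
    have hlt : (ν T ω : ℝ) < ⌈x * ψ T⌉₊ + 2 := by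
      exact_mod_cast not_le.1 (Set.notMem_ofPred_iff.1 hω)
    exact hlt.trans_le hceil
  have hsplit : 1 ≤ P {ω | ⌈x * ψ T⌉₊ + 2 ≤ ν T ω} + 1 / 2 := by
    calc 1 = P Set.univ := measure_univ.symm
      _ ≤ P {ω | ⌈x * ψ T⌉₊ + 2 ≤ ν T ω} + P {ω | ⌈x * ψ T⌉₊ + 2 ≤ ν T ω}ᶜ :=
          measure_univ_le_add_compl _
      _ ≤ P {ω | ⌈x * ψ T⌉₊ + 2 ≤ ν T ω} + 1 / 2 := by gcongr
  rw [← tsub_le_iff_right, one_div, ENNReal.one_sub_inv_two] at hsplit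
  simpa using hsplit

namespace IsCatastropheChain

variable {Ω : Type*} [MeasurableSpace Ω] {P : Measure Ω} [IsProbabilityMeasure P] {lam mu : ℝ}
  {η : ℕ → Ω → ℕ}

lemma exists_measure_randomIndex_ge_le_exp (hη : IsCatastropheChain P lam mu η) (hlam : 0 < lam)
    (hmu : 0 ≤ mu) {s : ℝ} (hs : 0 < s) (hs' : s < Real.log ((lam + mu) / lam)) :
    ∃ C : ℝ, 0 < C ∧ ∀ N : Ω → ℕ, Measurable N → (∀ k, IndepFun (η k) N P) → ∀ x : ℝ,
      P {ω | x ≤ η (N ω) ω} ≤ ENNReal.ofReal (C * Real.exp (-(s * x))) := by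
  obtain ⟨C, hC, htail⟩ := hη.exists_measure_ge_le_exp hlam hmu hs hs'
  refine ⟨C, hC, fun N hN hηN x => ?_⟩
  calc P {ω | x ≤ η (N ω) ω} = ∫⁻ ω, P {ω' | x ≤ η (N ω) ω'} ∂P :=
        measure_randomIndex_mem hN hηN (S := {n : ℕ | x ≤ n}) MeasurableSet.of_discrete
    _ ≤ ∫⁻ _, ENNReal.ofReal (C * Real.exp (-(s * x))) ∂P := by
        gcongr with ω
        exact htail (N ω) x
    _ = ENNReal.ofReal (C * Real.exp (-(s * x))) := by simp

lemma exists_le_measure_randomIndex_eq (hη : IsCatastropheChain P lam mu η) (hlam : 0 < lam)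
    (hmu : 0 < mu) :
    ∃ c : ℝ, 0 < c ∧ ∀ N : Ω → ℕ, Measurable N → (∀ k, IndepFun (η k) N P) → ∀ n,
      ENNReal.ofReal (c * (lam / (lam + mu)) ^ n) * P {ω | n + 2 ≤ N ω}
        ≤ P {ω | η (N ω) ω = n} := by
  obtain ⟨c, hc, hlocal⟩ := hη.exists_le_measure_eq hlam hmu
  refine ⟨c, hc, fun N hN hηN n => ?_⟩
  calc ENNReal.ofReal (c * (lam / (lam + mu)) ^ n) * P {ω | n + 2 ≤ N ω}
      ≤ ∫⁻ ω, P {ω' | η (N ω) ω' = n} ∂P :=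
        mul_measure_le_lintegral
          ((measurable_of_countable fun k => P {ω' | η k ω' = n}).comp hN)
          fun ω hω => hlocal n (N ω) hω
    _ = P {ω | η (N ω) ω = n} :=
        (measure_randomIndex_mem hN hηN (measurableSet_singleton n)).symm

variable {ι : Type*} {L : Filter ι} [L.NeBot] {ν : ι → Ω → ℕ} {ψ : ι → ℝ}

lemma limsup_normalizedLog_ge_le (hη : IsCatastropheChain P lam mu η) (hlam : 0 < lam)
    (hmu : 0 < mu) (hν : ∀ T, Measurable (ν T)) (hην : ∀ k T, IndepFun (η k) (ν T) P)
    (hψ : Tendsto ψ L atTop) (x : ℝ) :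
    limsup (normalizedLog ψ fun T => P {ω | x ≤ (η (ν T ω) ω : ℝ) / ψ T}) L
      ≤ ((-(x * Real.log ((lam + mu) / lam)) : ℝ) : EReal) := by
  have hl := log_add_div_pos hlam hmu
  have hbound : ∀ s ∈ Set.Ioo 0 (Real.log ((lam + mu) / lam)),
      limsup (normalizedLog ψ fun T => P {ω | x ≤ (η (ν T ω) ω : ℝ) / ψ T}) L
        ≤ ((-(x * s) : ℝ) : EReal) := fun s ⟨hs, hs'⟩ => by
    obtain ⟨C, hC, htail⟩ := hη.exists_measure_randomIndex_ge_le_exp hlam hmu.le hs hs'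
    refine limsup_normalizedLog_le hψ hC (g := fun T => -(s * (x * ψ T))) ?_ ?_
    · refine tendsto_const_nhds.congr' ?_
      filter_upwards [hψ.eventually_ne_atTop 0] with T hT
      field_simp
    · filter_upwards [hψ.eventually_gt_atTop 0] with T hT
      simp only [le_div_iff₀ hT]
      exact htail (ν T) (hν T) (fun k => hην k T) (x * ψ T)
  have hlim : Tendsto (fun s : ℝ => ((-(x * s) : ℝ) : EReal)) (𝓝[<] Real.log ((lam + mu) / lam))
      (𝓝 ((-(x * Real.log ((lam + mu) / lam)) : ℝ) : EReal)) :=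
    ((continuous_coe_real_ereal.comp (by fun_prop)).tendsto _).mono_left nhdsWithin_le_nhds
  exact ge_of_tendsto hlim (eventually_of_mem (Ioo_mem_nhdsLT hl) hbound)

lemma le_liminf_normalizedLog_mem (hη : IsCatastropheChain P lam mu η) (hlam : 0 < lam)
    (hmu : 0 < mu) (hν : ∀ T, Measurable (ν T)) (hην : ∀ k T, IndepFun (η k) (ν T) P)
    (hψ : Tendsto ψ L atTop)
    (hνψ : ∀ x : ℝ, Tendsto (fun T => P {ω | (ν T ω : ℝ) < x * ψ T}) L (𝓝 0))
    {x : ℝ} (hx : 0 ≤ x) {U : Set ℝ} (hU : U ∈ 𝓝 x) :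
    ((-(x * Real.log ((lam + mu) / lam)) : ℝ) : EReal)
      ≤ liminf (normalizedLog ψ fun T => P {ω | (η (ν T ω) ω : ℝ) / ψ T ∈ U}) L := by
  obtain ⟨c, hc, hlocal⟩ := hη.exists_le_measure_randomIndex_eq hlam hmu
  have hceil : Tendsto (fun T => (⌈x * ψ T⌉₊ : ℝ) / ψ T) L (𝓝 x) :=
    (tendsto_nat_ceil_mul_div_atTop hx).comp hψ
  have hg : Tendsto (fun T => -(⌈x * ψ T⌉₊ * Real.log ((lam + mu) / lam)) / ψ T) L
      (𝓝 (-(x * Real.log ((lam + mu) / lam)))) := by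
    refine (hceil.mul_const (Real.log ((lam + mu) / lam))).neg.congr fun T => ?_
    ring
  have hpow : ∀ n : ℕ,
      (lam / (lam + mu)) ^ n = Real.exp (-(n * Real.log ((lam + mu) / lam))) := fun n => by
    rw [← mul_neg, ← Real.log_inv, inv_div, Real.exp_nat_mul, Real.exp_log (by positivity)]
  refine le_liminf_normalizedLog hψ (half_pos hc) hg ?_
  filter_upwards [hceil.eventually hU, eventually_half_le_measure_ceil_add_two_le hψ hνψ hx]
    with T hTU hclock
  calc ENNReal.ofReal (c / 2 * Real.exp (-(⌈x * ψ T⌉₊ * Real.log ((lam + mu) / lam))))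
      = ENNReal.ofReal (c * (lam / (lam + mu)) ^ ⌈x * ψ T⌉₊) * ENNReal.ofReal (1 / 2) := by
        rw [← ENNReal.ofReal_mul (by positivity), hpow]
        ring_nf
    _ ≤ ENNReal.ofReal (c * (lam / (lam + mu)) ^ ⌈x * ψ T⌉₊) * P {ω | ⌈x * ψ T⌉₊ + 2 ≤ ν T ω} := by
        gcongr
    _ ≤ P {ω | η (ν T ω) ω = ⌈x * ψ T⌉₊} := hlocal (ν T) (hν T) (fun k => hην k T) _
    _ ≤ P {ω | (η (ν T ω) ω : ℝ) / ψ T ∈ U} := measure_mono fun ω hω => by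
        rwa [Set.mem_ofPred_eq, show η (ν T ω) ω = ⌈x * ψ T⌉₊ from hω]

end IsCatastropheChain

lemma tendsto_atTop_of_div_rpow {a : ℝ} (ha : 0 < a) {φ : ℝ≥0 → ℝ}
    (hφ : Tendsto (fun T : ℝ≥0 => φ T / (T : ℝ) ^ a) atTop atTop) : Tendsto φ atTop atTop := by
  refine (hφ.atTop_mul_atTop₀
    ((tendsto_rpow_atTop ha).comp (NNReal.tendsto_coe_atTop.2 tendsto_id))).congr' ?_
  filter_upwards [eventually_gt_atTop 0] with T hT
  exact div_mul_cancel₀ _ (Real.rpow_pos_of_pos (NNReal.coe_pos.2 hT) a).ne'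

theorem mainTheorem2_general {Ω : Type*} [MeasurableSpace Ω] {P : Measure Ω}
    [IsProbabilityMeasure P] {lam mu : ℝ} (hlam : 0 < lam) (hmu : 0 < mu)
    {η : ℕ → Ω → ℕ} (hη : IsCatastropheChain P lam mu η)
    {ν : ℝ≥0 → Ω → ℕ} (hν : ∀ T, Measurable (ν T)) (hην : ∀ k T, IndepFun (η k) (ν T) P)
    {φ : ℝ≥0 → ℝ} (hφ : Tendsto φ atTop atTop)
    (hνφ : ∀ x : ℝ, Tendsto (fun T => P {ω | (ν T ω : ℝ) < x * φ T}) atTop (𝓝 0)) :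
    SatisfiesLDP P (fun T => scaledProcess (catastropheProcess η ν) φ T 1) φ
      (rateI₁ lam mu) := by
  have hl := log_add_div_pos hlam hmu
  have hξ : (fun T => scaledProcess (catastropheProcess η ν) φ T 1)
      = fun T ω => (η (ν T ω) ω : ℝ) / φ T := by
    funext T ω
    rw [scaledProcess, catastropheProcess, mul_one]
  rw [hξ]
  refine satisfiesLDP_exponentialRate hl hφ ?_
    (fun x _ => hη.limsup_normalizedLog_ge_le hlam hmu hν hην hφ x)
    (fun x hx U hU => hη.le_liminf_normalizedLog_mem hlam hmu hν hην hφ hνφ hx hU)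
  filter_upwards [hφ.eventually_ge_atTop 0] with T hT ω
  positivity

theorem mainTheorem2 {Ω : Type*} [MeasurableSpace Ω] (P : Measure Ω) [IsProbabilityMeasure P]
    (lam mu : ℝ) (hlam : 0 < lam) (hmu : 0 < mu) (α : ℝ≥0) (hα : 0 < α)
    (η : ℕ → Ω → ℕ) (hη : IsCatastropheChain P lam mu η)
    (ν : ℝ≥0 → Ω → ℕ) (hν : IsPoissonProcess P α ν)
    (hην : IndepFun (fun ω k => η k ω) (fun ω t => ν t ω) P)
    (φ : ℝ≥0 → ℝ)
    (hφ_sublinear : Tendsto (fun T : ℝ≥0 => φ T / (T : ℝ)) atTop (𝓝 0))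
    (hφ_power : ∃ a : ℝ, 0 < a ∧ a < 1 ∧
      Tendsto (fun T : ℝ≥0 => φ T / (T : ℝ) ^ a) atTop atTop) :
    SatisfiesLDP P (fun T => scaledProcess (catastropheProcess η ν) φ T 1) φ
      (rateI₁ lam mu) := by
  obtain ⟨a, ha, -, hφ_div⟩ := hφ_power
  exact mainTheorem2_general hlam hmu hη hν.measurable
    (fun k T => hην.comp (measurable_pi_apply k) (measurable_pi_apply T))
    (tendsto_atTop_of_div_rpow ha hφ_div) fun x => hν.tendsto_measure_lt_zero hα <| by
      simpa only [mul_div_assoc, mul_zero] using hφ_sublinear.const_mul x
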